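/- For $x\in\mathbb{R}^2$, $r>0$, $0<\alpha<1$ and a line $\ell\in G(2,1)$ through the origin (a one-dimensional linear subspace of $\mathbb{R}^2$), let $$X(x,r,\ell,\alpha)=\{y\in\mathbb{R}^2 : |y-x|\le r,\ \operatorname{dist}(y-x,\ell)<\alpha|y-x|\}.$$ Let $\mathcal{H}^1$ be the one-dimensional Hausdorff measure on $\mathbb{R}^2$. A set $E\subset\mathbb{R}^2$ is $1$-rectifiable if there are Lipschitz maps $f_i\colon\mathbb{R}\to\mathbb{R}^2$, $i\in\mathbb{N}$, with $\mathcal{H}^1\bigl(E\setminus\bigcup_i f_i(\mathbb{R})\bigr)=0$, and a set $A\subset\mathbb{R}^2$ is purely $1$-unrectifiable if $\mathcal{H}^1(A\cap E)=0$ for every $1$-rectifiable set $E\subset\mathbb{R}^2$. There exists a purely $1$-unrectifiable compact set $A\subset\mathbb{R}^2$ with $0<\mathcal{H}^1(A)<\infty$ such that for every $0<\alpha<1$ and every $x\in A$ $$\lim_{r\downarrow 0}\ \inf_{\ell\in G(2,1)}\frac{\mathcal{H}^1\bigl(A\cap X(x,r,\ell,\alpha)\bigr)}{2r}=0.$$ In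 particular, for this set $A$ there are no $0<\alpha<1$ and $c>0$ such that $$\limsup_{r\downarrow 0}\ \inf_{\ell\in G(2,1)}\frac{\mathcal{H}^1\bigl(A\cap X(x,r,\ell,\alpha)\bigr)}{2r}>c\quad\text{for }\mathcal{H}^1\text{-almost all }x\in A.$$ -/

import Mathlib

open Set Filter Topology MeasureTheory

/-- The cone `X(x, r, V, α) = {y ∈ B(x, r) : dist (y - x, V) < α |y - x|}`, where `B(x, r)` is the
closed ball of radius `r` centred at `x`. -/
def cone {n : ℕ} (x : EuclideanSpace ℝ (Fin n)) (r : ℝ)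
    (V : Submodule ℝ (EuclideanSpace ℝ (Fin n))) (α : ℝ) : Set (EuclideanSpace ℝ (Fin n)) :=
  Metric.closedBall x r ∩
    {y | Metric.infDist (y - x) (V : Set (EuclideanSpace ℝ (Fin n))) < α * ‖y - x‖}

/-- `G(n, k)`: the set of all `k`-dimensional linear subspaces of `ℝⁿ`. -/
def linSubspaces (n k : ℕ) : Set (Submodule ℝ (EuclideanSpace ℝ (Fin n))) :=
  {V | Module.finrank ℝ V = k}

/-- A set `E ⊆ ℝⁿ` is `m`-rectifiable if `ℋᵐ`-almost all of it is covered by countably many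
Lipschitz images of `ℝᵐ`. -/
def IsRectifiableSet {n : ℕ} (m : ℕ) (E : Set (EuclideanSpace ℝ (Fin n))) : Prop :=
  ∃ f : ℕ → EuclideanSpace ℝ (Fin m) → EuclideanSpace ℝ (Fin n),
    (∀ i, ∃ K : NNReal, LipschitzWith K (f i)) ∧
      Measure.hausdorffMeasure (m : ℝ) (E \ ⋃ i, range (f i)) = 0

/-- A set `A ⊆ ℝⁿ` is purely `m`-unrectifiable if it meets every `m`-rectifiable set in an
`ℋᵐ`-null set. -/
def IsPurelyUnrectifiable {n : ℕ} (m : ℕ) (A : Set (EuclideanSpace ℝ (Fin n))) : Prop :=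
  ∀ E : Set (EuclideanSpace ℝ (Fin n)), IsRectifiableSet m E →
    Measure.hausdorffMeasure (m : ℝ) (A ∩ E) = 0

/-- `inf_{V ∈ G(n, n-m)} ℋᵐ(A ∩ X(x, r, V, α)) / (2r)ᵐ`, as an extended nonnegative number.
It is only meaningful for `m ≤ n` and `r > 0`. -/
noncomputable def infConeRatio {n : ℕ} (m : ℕ) (A : Set (EuclideanSpace ℝ (Fin n))) (α : ℝ)
    (x : EuclideanSpace ℝ (Fin n)) (r : ℝ) : ENNReal :=
  ⨅ V ∈ linSubspaces n (n - m),
    Measure.hausdorffMeasure (m : ℝ) (A ∩ cone x r V α) / ENNReal.ofReal ((2 * r) ^ m)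

/-! Start from the unit segment. Cut each segment of generation `n` into `2 ^ (2 * n + 10)` equal
pieces and rotate every piece about its centre by an angle with cosine `(n + 1) / (n + 2)`, the
signs alternating along the segment. Keep the limit points whose parameters avoid small
neighbourhoods of all cell endpoints. The angles tend to `0`, yet so slowly that the products of
their cosines tend to `0` as well.

Flatness comes from the small angles. If `n` is the last generation in which two parameters share a
cell, their images differ by a vector parallel to the segment of generation `n` up to a relative
error of order `chord n` (`le_abs_inner_zigzag_sub`). At a suitable radius `r`, the cone about the
line perpendicular to `dir n t` therefore misses everything but a cell of generation `n + 2`. Pieces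
shrink much faster than gaps, so this cell has measure `o(r)` (`infConeRatio_flatSet_le`).

Unrectifiability comes from the vanishing products. The parametrization has a Lipschitz inverse and
at most triples measure, so Lebesgue-null parameter sets are negligible. A Lipschitz curve meeting
the set in positive measure would have tangents there, forcing `dir n` to converge on a parameter
set of positive measure (`tendsto_dir_of_hasDerivAt`). But the mean of `dir (n + d)` over a cell of
generation `n` has modulus a product of cosines, which tends to `0` in `d`, so by Lebesgue density
the unit vectors `dir n t` diverge for almost every `t` (`ae_not_tendsto_dir`). -/

namespace ZigzagCantor

/-! ### The construction -/

/-- The number of cells of generation `n` in the unit interval. -/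
def scale (n : ℕ) : ℕ := 2 ^ (n ^ 2 + 9 * n)

/-- The proportion of a cell of generation `n` that is removed near each of its endpoints. -/
noncomputable def gap (n : ℕ) : ℝ := (1 / 2) ^ (n + 4)

/-- The cosine of the turning angle between generations `n` and `n + 1`. -/
noncomputable def cosTurn (n : ℕ) : ℝ := (n + 1) / (n + 2)

/-- The sine of the turning angle between generations `n` and `n + 1`. -/
noncomputable def sinTurn (n : ℕ) : ℝ := √(1 - cosTurn n ^ 2)

/-- The length of the chord of the turning angle between generations `n` and `n + 1`. -/
noncomputable def chord (n : ℕ) : ℝ := √(2 / (n + 2))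

/-- The sign `(-1) ^ j`. -/
noncomputable def altSign (j : ℤ) : ℝ := if Even j then 1 else -1

/-- The index of the cell of generation `n` containing `t`. -/
noncomputable def cell (n : ℕ) (t : ℝ) : ℤ := ⌊(scale n : ℝ) * t⌋

/-- The rotation applied at `t` between generations `n` and `n + 1`. -/
noncomputable def turn (n : ℕ) (t : ℝ) : ℂ :=
  ⟨cosTurn n, altSign (cell (n + 1) t) * sinTurn n⟩

/-- The direction of the segment of generation `n` at the parameter `t`. -/
noncomputable def dir : ℕ → ℝ → ℂ
  | 0, _ => 1
  | n + 1, t => dir n t * turn n t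

/-- The signed distance from `t` to the centre of its cell of generation `n`. -/
noncomputable def offset (n : ℕ) (t : ℝ) : ℝ := t - (cell n t + 1 / 2) / scale n

/-- The parametrization of the union of segments of generation `n`. -/
noncomputable def approx : ℕ → ℝ → ℂ
  | 0, t => t
  | n + 1, t => approx n t + offset (n + 1) t * (dir (n + 1) t - dir n t)

/-- The limit of the parametrizations `approx n`. -/
noncomputable def zigzag (t : ℝ) : ℂ := limUnder atTop fun n => approx n t

/-- The parameters that stay away from the endpoints of the cells of all generations. -/
def params : Set ℝ :=
  {t | t ∈ Icc (0 : ℝ) 1 ∧ ∀ (n : ℕ) (j : ℤ), gap n ≤ |scale n * t - j|}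

/-! ### Scales, gaps and turning angles -/

lemma scale_pos (n : ℕ) : (0 : ℝ) < scale n := by
  simp [scale]

lemma scale_zero : scale 0 = 1 := by simp [scale]

lemma scale_succ (n : ℕ) : scale (n + 1) = scale n * 2 ^ (2 * n + 10) := by
  rw [scale, scale, ← pow_add]; congr 1; ring

lemma scale_succ_real (n : ℕ) : (scale (n + 1) : ℝ) = scale n * 2 ^ (2 * n + 10) := by
  rw [scale_succ]; push_cast; ring

lemma two_pow_mul_scale_le (n k : ℕ) : (2 : ℝ) ^ k * scale n ≤ scale (n + k) := by
  simp only [scale]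
  push_cast
  rw [← pow_add]
  refine pow_le_pow_right₀ (by norm_num) ?_
  nlinarith [Nat.zero_le (n * k), Nat.zero_le (k * k)]

lemma two_pow_le_scale (n : ℕ) : (2 : ℝ) ^ n ≤ scale n := by
  simpa [scale_zero] using two_pow_mul_scale_le 0 n

lemma tendsto_inv_scale : Tendsto (fun n => (1 : ℝ) / scale n) atTop (𝓝 0) := by
  have h : Tendsto (fun n : ℕ => ((1 : ℝ) / 2) ^ n) atTop (𝓝 0) :=
    tendsto_pow_atTop_nhds_zero_of_lt_one (by norm_num) (by norm_num)
  refine squeeze_zero (fun n => (div_pos one_pos (scale_pos n)).le) (fun n => ?_) h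
  rw [div_pow, one_pow]
  exact one_div_le_one_div_of_le (by positivity) (two_pow_le_scale n)

lemma gap_pos (n : ℕ) : 0 < gap n := by unfold gap; positivity

/-- The exponent in `scale` is quadratic exactly so that a cell is negligible even against the gaps
of the preceding generation. Both the stability of directions and the smallness of the cone measure
rest on this. -/
lemma inv_scale_succ_le (n : ℕ) :
    1 / (scale (n + 2) : ℝ) = (1 / 2) ^ (n + 7) * (gap (n + 1) / scale (n + 1)) := by
  have := (scale_pos (n + 1)).ne'
  rw [scale_succ_real (n + 1), gap, show 2 * (n + 1) + 10 = (n + 7) + (n + 1 + 4) by ring, pow_add]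
  rw [one_div_pow, one_div_pow]
  field_simp

lemma chord_nonneg (n : ℕ) : 0 ≤ chord n := Real.sqrt_nonneg _

lemma chord_sq (n : ℕ) : chord n ^ 2 = 2 / (n + 2) := Real.sq_sqrt (by positivity)

lemma chord_antitone : Antitone chord := by
  intro m n h
  have : (m : ℝ) ≤ n := by exact_mod_cast h
  exact Real.sqrt_le_sqrt (by gcongr)

lemma chord_le_one (n : ℕ) : chord n ≤ 1 := by
  refine Real.sqrt_le_one.2 ((div_le_one (by positivity)).2 ?_)
  have : (0 : ℝ) ≤ n := n.cast_nonneg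
  linarith

lemma tendsto_chord : Tendsto chord atTop (𝓝 0) := by
  have h : Tendsto (fun n : ℕ => (2 : ℝ) / (n + 2)) atTop (𝓝 0) :=
    tendsto_const_nhds.div_atTop
      (tendsto_atTop_add_const_right _ _ tendsto_natCast_atTop_atTop)
  have h' := (Real.continuous_sqrt.tendsto 0).comp h
  rwa [Real.sqrt_zero] at h'

lemma cosTurn_eq (n : ℕ) : cosTurn n = 1 - chord n ^ 2 / 2 := by
  rw [chord_sq, cosTurn]
  have : (0 : ℝ) < n + 2 := by positivity
  field_simp
  ring

lemma half_le_cosTurn (n : ℕ) : 1 / 2 ≤ cosTurn n := by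
  have := chord_le_one n
  have := chord_nonneg n
  rw [cosTurn_eq]; nlinarith

lemma cosTurn_le_one (n : ℕ) : cosTurn n ≤ 1 := by
  rw [cosTurn_eq]; nlinarith [sq_nonneg (chord n)]

lemma sinTurn_nonneg (n : ℕ) : 0 ≤ sinTurn n := Real.sqrt_nonneg _

lemma sinTurn_sq (n : ℕ) : sinTurn n ^ 2 = 1 - cosTurn n ^ 2 :=
  Real.sq_sqrt (by nlinarith [half_le_cosTurn n, cosTurn_le_one n])

lemma sinTurn_le_chord (n : ℕ) : sinTurn n ≤ chord n := by
  refine abs_le_of_sq_le_sq' ?_ (chord_nonneg n) |>.2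
  rw [sinTurn_sq, cosTurn_eq]
  nlinarith [sq_nonneg (chord n ^ 2)]

lemma altSign_sq (j : ℤ) : altSign j ^ 2 = 1 := by
  unfold altSign; split_ifs <;> norm_num

lemma altSign_add_one (j : ℤ) : altSign (j + 1) = -altSign j := by
  unfold altSign
  by_cases h : Even j <;> simp [h, parity_simps]

lemma norm_turn (n : ℕ) (t : ℝ) : ‖turn n t‖ = 1 := by
  have : ‖turn n t‖ ^ 2 = 1 := by
    rw [← Complex.normSq_eq_norm_sq, Complex.normSq_apply]
    simp only [turn]
    linear_combination sinTurn n ^ 2 * altSign_sq (cell (n + 1) t) + sinTurn_sq n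
  exact (pow_eq_one_iff_of_nonneg (norm_nonneg _) two_ne_zero).1 this

lemma norm_turn_sub_one (n : ℕ) (t : ℝ) : ‖turn n t - 1‖ = chord n := by
  have : ‖turn n t - 1‖ ^ 2 = chord n ^ 2 := by
    rw [← Complex.normSq_eq_norm_sq, Complex.normSq_apply]
    simp only [turn, Complex.sub_re, Complex.sub_im, Complex.one_re, Complex.one_im]
    have := cosTurn_eq n
    linear_combination sinTurn n ^ 2 * altSign_sq (cell (n + 1) t) + sinTurn_sq n - 2 * this
  exact (sq_eq_sq₀ (norm_nonneg _) (chord_nonneg n)).1 this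

lemma norm_dir (n : ℕ) (t : ℝ) : ‖dir n t‖ = 1 := by
  induction n with
  | zero => simp [dir]
  | succ n ih => rw [dir, norm_mul, ih, norm_turn, one_mul]

lemma norm_dir_succ_sub (n : ℕ) (t : ℝ) : ‖dir (n + 1) t - dir n t‖ = chord n := by
  rw [dir, show dir n t * turn n t - dir n t = dir n t * (turn n t - 1) by ring, norm_mul,
    norm_dir, one_mul, norm_turn_sub_one]

/-! ### Convergence of the approximations -/

lemma offset_eq (n : ℕ) (t : ℝ) :
    offset n t = (Int.fract (scale n * t) - 1 / 2) / scale n := by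
  have := (scale_pos n).ne'
  rw [offset, cell, Int.fract]
  field_simp
  ring

lemma abs_offset_le (n : ℕ) (t : ℝ) : |offset n t| ≤ 1 / 2 / scale n := by
  rw [offset_eq, abs_div, abs_of_pos (scale_pos n)]
  have h0 := Int.fract_nonneg ((scale n : ℝ) * t)
  have h1 := Int.fract_lt_one ((scale n : ℝ) * t)
  have := scale_pos n
  gcongr
  rw [abs_le]; constructor <;> linarith

lemma norm_approx_succ_sub_le (n : ℕ) (t : ℝ) :
    ‖approx (n + 1) t - approx n t‖ ≤ chord n * (1 / 2 / scale (n + 1)) := by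
  rw [approx, add_sub_cancel_left, norm_mul, norm_dir_succ_sub, Complex.norm_real, Real.norm_eq_abs,
    mul_comm]
  exact mul_le_mul_of_nonneg_left (abs_offset_le _ _) (chord_nonneg n)

lemma dist_approx_add_le (n k : ℕ) (t : ℝ) :
    dist (approx (n + k) t) (approx (n + (k + 1)) t) ≤
      chord n * (1 / 2 / scale (n + 1)) * (1 / 2) ^ k := by
  rw [dist_comm, dist_eq_norm, ← add_assoc]
  refine (norm_approx_succ_sub_le (n + k) t).trans ?_
  have h1 := chord_antitone (Nat.le_add_right n k)
  have h2 : (1 : ℝ) / 2 / scale (n + k + 1) ≤ 1 / 2 / scale (n + 1) * (1 / 2) ^ k := by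
    have := two_pow_mul_scale_le (n + 1) k
    rw [show n + 1 + k = n + k + 1 by ring] at this
    have hs := scale_pos (n + 1)
    calc (1 : ℝ) / 2 / scale (n + k + 1) ≤ 1 / 2 / (2 ^ k * scale (n + 1)) := by gcongr
      _ = _ := by rw [one_div_pow]; field_simp
  have := chord_nonneg n
  have := scale_pos (n + k + 1)
  calc _ ≤ chord n * (1 / 2 / scale (n + 1) * (1 / 2) ^ k) := by gcongr
    _ = _ := by ring

lemma tendsto_approx (t : ℝ) : Tendsto (fun n => approx n t) atTop (𝓝 (zigzag t)) := by
  have h : CauchySeq fun n => approx (0 + n) t :=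
    cauchySeq_of_le_geometric (1 / 2) (chord 0 * (1 / 2 / scale (0 + 1))) (by norm_num)
      fun k => dist_approx_add_le 0 k t
  simp only [zero_add] at h
  exact h.tendsto_limUnder

lemma norm_zigzag_sub_approx_le (n : ℕ) (t : ℝ) :
    ‖zigzag t - approx n t‖ ≤ chord n / scale (n + 1) := by
  have h1 : Tendsto (fun k => approx (n + k) t) atTop (𝓝 (zigzag t)) := by
    simpa [add_comm, Function.comp_def] using (tendsto_approx t).comp (tendsto_add_atTop_nat n)
  have h2 := dist_le_of_le_geometric_of_tendsto₀ (1 / 2) (chord n * (1 / 2 / scale (n + 1)))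
    (by norm_num) (fun k => dist_approx_add_le n k t) h1
  rw [dist_comm, dist_eq_norm, add_zero] at h2
  refine h2.trans (le_of_eq ?_)
  have := (scale_pos (n + 1)).ne'
  field_simp
  norm_num

lemma cell_eq_ediv (n : ℕ) (t : ℝ) : cell n t = cell (n + 1) t / (2 ^ (2 * n + 10) : ℕ) := by
  rw [cell, cell, ← Int.floor_div_natCast, scale_succ_real]
  push_cast
  congr 1
  field_simp

lemma cell_eq_of_le {m n : ℕ} {s t : ℝ} (h : cell n s = cell n t) (hmn : m ≤ n) :
    cell m s = cell m t := by
  induction n, hmn using Nat.le_induction with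
  | base => exact h
  | succ n _ ih => exact ih (by rw [cell_eq_ediv, h, ← cell_eq_ediv])

lemma dir_eq_of_cell_eq {n : ℕ} {s t : ℝ} (h : cell n s = cell n t) : dir n s = dir n t := by
  induction n with
  | zero => rfl
  | succ n ih => rw [dir, dir, ih (cell_eq_of_le h n.le_succ), turn, turn, h]

lemma approx_sub_of_cell_eq {n : ℕ} {s t : ℝ} (h : cell n s = cell n t) :
    approx n s - approx n t = (s - t : ℝ) * dir n t := by
  induction n with
  | zero => simp [approx, dir]
  | succ n ih =>
    have h' := cell_eq_of_le h n.le_succ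
    have hd := dir_eq_of_cell_eq h
    have hd' := dir_eq_of_cell_eq h'
    have ho : (offset (n + 1) s : ℂ) = offset (n + 1) t + (s - t : ℝ) := by
      rw [offset, offset, h]; push_cast; ring
    have := ih h'
    rw [approx, approx, hd, hd', ho]
    linear_combination this

lemma abs_sub_lt_of_cell_eq {n : ℕ} {s t : ℝ} (h : cell n s = cell n t) :
    |s - t| < 1 / scale n := by
  have := Int.abs_sub_lt_one_of_floor_eq_floor h
  rw [← mul_sub, abs_mul, abs_of_pos (scale_pos n)] at this
  rwa [lt_div_iff₀' (scale_pos n)]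

/-- On one cell `approx n` is an isometry onto a segment, and the later generations move each point
by at most `chord n / scale (n + 1)`. -/
lemma norm_zigzag_sub_sub_le {n : ℕ} {s t : ℝ} (h : cell n s = cell n t) :
    ‖zigzag s - zigzag t - (s - t : ℝ) * dir n t‖ ≤ 2 * chord n / scale (n + 1) := by
  have h1 := norm_zigzag_sub_approx_le n s
  have h2 := norm_zigzag_sub_approx_le n t
  rw [← approx_sub_of_cell_eq h]
  calc _ = ‖(zigzag s - approx n s) - (zigzag t - approx n t)‖ := by congr 1; ring
    _ ≤ _ := norm_sub_le _ _
    _ ≤ chord n / scale (n + 1) + chord n / scale (n + 1) := add_le_add h1 h2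
    _ = _ := by ring

lemma norm_zigzag_sub_le {n : ℕ} {s t : ℝ} (h : cell n s = cell n t) :
    ‖zigzag s - zigzag t‖ ≤ 3 / scale n := by
  have h1 := norm_zigzag_sub_sub_le h
  have h2 : ‖((s - t : ℝ) : ℂ) * dir n t‖ ≤ 1 / scale n := by
    rw [norm_mul, norm_dir, mul_one, Complex.norm_real]
    exact (abs_sub_lt_of_cell_eq h).le
  have h3 : 2 * chord n / scale (n + 1) ≤ 2 / scale n := by
    have a := two_pow_mul_scale_le n 1
    have b := chord_le_one n
    have c := scale_pos n
    exact div_le_div₀ zero_le_two (by linarith) c (by linarith)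
  have h4 := norm_sub_norm_le (zigzag s - zigzag t) ((s - t : ℝ) * dir n t)
  have : (3 : ℝ) / scale n = 2 / scale n + 1 / scale n := by ring
  linarith

/-! ### Chords point along the last common segment -/

/-- The zigzag function of slope `±1` and period `2`. -/
noncomputable def triangleWave (x : ℝ) : ℝ := altSign ⌊x⌋ * (Int.fract x - 1 / 2)

lemma abs_triangleWave_sub_le (x y : ℝ) : |triangleWave x - triangleWave y| ≤ |x - y| := by
  wlog hxy : x ≤ y generalizing x y
  · rw [abs_sub_comm, abs_sub_comm x]; exact this y x (not_le.1 hxy).le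
  have hx := Int.floor_add_fract x
  have hy := Int.floor_add_fract y
  have hx0 := Int.fract_nonneg x
  have hy0 := Int.fract_nonneg y
  have hx1 := Int.fract_lt_one x
  have hy1 := Int.fract_lt_one y
  have hf := Int.floor_mono hxy
  rw [abs_sub_comm x, abs_of_nonneg (sub_nonneg.2 hxy)]
  have hs : altSign ⌊x⌋ = 1 ∨ altSign ⌊x⌋ = -1 := by unfold altSign; split_ifs <;> simp
  have hs' : altSign ⌊y⌋ = 1 ∨ altSign ⌊y⌋ = -1 := by unfold altSign; split_ifs <;> simp
  unfold triangleWave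
  rcases hf.eq_or_lt with h | h
  · rw [h] at hx hs ⊢
    rw [abs_le]
    rcases hs with h1 | h1 <;> rw [h1] <;> constructor <;> linarith
  rcases (Int.add_one_le_of_lt h).eq_or_lt with h' | h'
  · rw [← h', altSign_add_one, abs_le]
    rw [← h'] at hy
    push_cast at hy
    rcases hs with h1 | h1 <;> rw [h1] <;> constructor <;> linarith
  · have h'' : (⌊x⌋ : ℝ) + 2 ≤ ⌊y⌋ := by
      have := Int.add_one_le_of_lt h'
      exact_mod_cast (by linarith : ⌊x⌋ + 2 ≤ ⌊y⌋)
    rw [abs_le]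
    rcases hs with h1 | h1 <;> rcases hs' with h2 | h2 <;> rw [h1, h2] <;> constructor <;> linarith

lemma altSign_mul_offset (n : ℕ) (t : ℝ) :
    altSign (cell n t) * offset n t = triangleWave (scale n * t) / scale n := by
  rw [offset_eq, triangleWave, cell, mul_div_assoc]

lemma abs_altSign_mul_offset_sub_le (n : ℕ) (s t : ℝ) :
    |altSign (cell n s) * offset n s - altSign (cell n t) * offset n t| ≤ |s - t| := by
  have h := abs_triangleWave_sub_le (scale n * s) (scale n * t)
  rw [← mul_sub, abs_mul, abs_of_pos (scale_pos n)] at h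
  rw [altSign_mul_offset, altSign_mul_offset, ← sub_div, abs_div, abs_of_pos (scale_pos n),
    div_le_iff₀' (scale_pos n)]
  exact h

lemma offset_sub_le {n : ℕ} {s t : ℝ} (h : t ≤ s) : offset n s - offset n t ≤ s - t := by
  have h1 : cell n t ≤ cell n s :=
    Int.floor_mono (mul_le_mul_of_nonneg_left h (scale_pos n).le)
  have h2 : ((cell n t : ℝ) + 1 / 2) / scale n ≤ ((cell n s : ℝ) + 1 / 2) / scale n := by
    have := scale_pos n
    have : (cell n t : ℝ) ≤ cell n s := by exact_mod_cast h1
    gcongr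
  unfold offset
  linarith

/-- This is where alternating signs matter: in coordinates along `dir n t`, the height is `sinTurn
n` times a triangle wave, hence Lipschitz across cell endpoints. The horizontal part only gains
there, since `offset` jumps downwards. -/
lemma exists_approx_succ_sub {n : ℕ} {s t : ℝ} (h : cell n s = cell n t) :
    ∃ z : ℂ, approx (n + 1) s - approx (n + 1) t = dir n t * z ∧
      cosTurn n * |s - t| ≤ |z.re| ∧ |z.im| ≤ sinTurn n * |s - t| := by
  refine ⟨⟨(s - t) - (1 - cosTurn n) * (offset (n + 1) s - offset (n + 1) t),
    sinTurn n * (altSign (cell (n + 1) s) * offset (n + 1) s -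
      altSign (cell (n + 1) t) * offset (n + 1) t)⟩, ?_, ?_, ?_⟩
  · have h1 := approx_sub_of_cell_eq h
    have h2 : approx (n + 1) s - approx (n + 1) t = (s - t : ℝ) * dir n t +
        dir n t * (offset (n + 1) s * (turn n s - 1) - offset (n + 1) t * (turn n t - 1)) := by
      simp only [approx, dir, dir_eq_of_cell_eq h]
      linear_combination h1
    rw [h2, show ∀ a b c : ℂ, a * b + b * c = b * (a + c) by intros; ring]
    congr 1
    apply Complex.ext <;> simp [turn] <;> ring
  · have hc : 0 ≤ 1 - cosTurn n := by linarith [cosTurn_le_one n]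
    wlog hst : t ≤ s generalizing s t
    · have := this h.symm (not_le.1 hst).le
      rw [abs_sub_comm s]
      refine this.trans_eq ?_
      rw [← abs_neg]
      congr 1
      ring
    rw [abs_of_nonneg (sub_nonneg.2 hst)]
    refine le_trans ?_ (le_abs_self _)
    have := mul_le_mul_of_nonneg_left (offset_sub_le (n := n + 1) hst) hc
    simp only
    linarith
  · rw [abs_mul, abs_of_nonneg (sinTurn_nonneg n)]
    exact mul_le_mul_of_nonneg_left (abs_altSign_mul_offset_sub_le _ _ _) (sinTurn_nonneg n)

lemma cell_zero_of_mem {t : ℝ} (ht : t ∈ params) : cell 0 t = 0 := by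
  have h1 := ht.2 0 1
  have h2 := gap_pos 0
  rw [cell, Int.floor_eq_zero_iff]
  simp only [scale_zero, Nat.cast_one, one_mul, Int.cast_one] at *
  refine ⟨ht.1.1, lt_of_le_of_ne ht.1.2 fun h => ?_⟩
  rw [h] at h1
  simp at h1
  linarith

lemma cell_eq_of_abs_sub_lt {n : ℕ} {s t : ℝ} (ht : t ∈ params)
    (h : |s - t| < gap n / scale n) : cell n s = cell n t := by
  have h0 := ht.2 n (cell n t)
  have h1 := ht.2 n (cell n t + 1)
  have hM := scale_pos n
  have habs : |(s - t) * scale n| = |s - t| * scale n := by rw [abs_mul, abs_of_pos hM]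
  rw [lt_div_iff₀ hM, ← habs, sub_mul, abs_lt] at h
  have a := Int.floor_le ((scale n : ℝ) * t)
  have b := Int.lt_floor_add_one ((scale n : ℝ) * t)
  change (cell n t : ℝ) ≤ _ at a
  change _ < (cell n t : ℝ) + 1 at b
  rw [abs_of_nonneg (by linarith)] at h0
  push_cast at h1
  rw [abs_of_nonpos (by linarith)] at h1
  rw [cell, Int.floor_eq_iff]
  constructor <;> linarith

lemma gap_div_scale_le {n : ℕ} {s t : ℝ} (ht : t ∈ params) (h : cell n s ≠ cell n t) :
    gap n / scale n ≤ |s - t| := by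
  by_contra h'
  exact h (cell_eq_of_abs_sub_lt ht (not_le.1 h'))

lemma exists_last_common_cell {s t : ℝ} (hs : s ∈ params) (ht : t ∈ params) (hst : s ≠ t) :
    ∃ n, cell n s = cell n t ∧ cell (n + 1) s ≠ cell (n + 1) t := by
  by_contra! h
  have h1 : ∀ n, cell n s = cell n t := fun n => by
    induction n with
    | zero => rw [cell_zero_of_mem hs, cell_zero_of_mem ht]
    | succ n ih => exact h n ih
  have h2 := ge_of_tendsto' tendsto_inv_scale fun n => (abs_sub_lt_of_cell_eq (h1 n)).le
  exact hst (sub_eq_zero.1 (abs_nonpos_iff.1 h2))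

/-- Different cells of generation `n + 1` force a separation of at least one gap, which dominates
the displacement caused by all generations beyond `n + 1`. -/
lemma exists_zigzag_sub {n : ℕ} {s t : ℝ} (ht : t ∈ params) (h : cell n s = cell n t)
    (h' : cell (n + 1) s ≠ cell (n + 1) t) :
    ∃ z : ℂ, zigzag s - zigzag t = dir n t * z ∧
      |s - t| / 4 ≤ |z.re| ∧ |z.im| ≤ 2 * chord n * |s - t| := by
  obtain ⟨w, hw, hre, him⟩ := exists_approx_succ_sub h
  have hd : dir n t ≠ 0 := norm_ne_zero_iff.1 (by rw [norm_dir]; exact one_ne_zero)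
  set e := zigzag s - zigzag t - (approx (n + 1) s - approx (n + 1) t) with he
  have hne : ‖e / dir n t‖ ≤ chord n / 4 * |s - t| := by
    rw [norm_div, norm_dir, div_one]
    have h1 := norm_zigzag_sub_approx_le (n + 1) s
    have h2 := norm_zigzag_sub_approx_le (n + 1) t
    have h3 : ‖e‖ ≤ 2 * (chord (n + 1) * (1 / scale (n + 2))) := by
      calc ‖e‖ = ‖(zigzag s - approx (n + 1) s) - (zigzag t - approx (n + 1) t)‖ := by
            rw [he]; congr 1; ring
        _ ≤ _ := norm_sub_le _ _
        _ ≤ chord (n + 1) / scale (n + 2) + chord (n + 1) / scale (n + 2) := add_le_add h1 h2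
        _ = _ := by ring
    have h4 : 1 / (scale (n + 2) : ℝ) ≤ 1 / 8 * |s - t| := by
      rw [inv_scale_succ_le]
      have h5 : ((1 : ℝ) / 2) ^ (n + 7) ≤ 1 / 8 := by
        calc ((1 : ℝ) / 2) ^ (n + 7) ≤ (1 / 2) ^ 3 :=
              pow_le_pow_of_le_one (by norm_num) (by norm_num) (by omega)
          _ = _ := by norm_num
      exact mul_le_mul h5 (gap_div_scale_le ht h')
        (div_nonneg (gap_pos _).le (scale_pos _).le) (by norm_num)
    have h6 : chord (n + 1) ≤ chord n := chord_antitone n.le_succ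
    have := mul_le_mul h6 h4 (div_nonneg zero_le_one (scale_pos _).le) (chord_nonneg n)
    linarith
  refine ⟨w + e / dir n t, ?_, ?_, ?_⟩
  · rw [mul_add, mul_div_cancel₀ _ hd, ← hw, he]; ring
  · have h1 := (Complex.abs_re_le_norm _).trans hne
    have h2 := abs_sub_abs_le_abs_add w.re (e / dir n t).re
    have h3 := half_le_cosTurn n
    have h4 := chord_le_one n
    rw [Complex.add_re]
    nlinarith [abs_nonneg (s - t)]
  · have h1 := (Complex.abs_im_le_norm _).trans hne
    have h2 := abs_add_le w.im (e / dir n t).im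
    have h3 := sinTurn_le_chord n
    have h4 := chord_nonneg n
    rw [Complex.add_im]
    have h5 := mul_le_mul_of_nonneg_right h3 (abs_nonneg (s - t))
    have h6 := mul_nonneg h4 (abs_nonneg (s - t))
    linarith

lemma abs_sub_le_norm_zigzag_sub {s t : ℝ} (hs : s ∈ params) (ht : t ∈ params) :
    |s - t| ≤ 4 * ‖zigzag s - zigzag t‖ := by
  rcases eq_or_ne s t with rfl | hst
  · simp
  obtain ⟨n, h, h'⟩ := exists_last_common_cell hs ht hst
  obtain ⟨z, hz, hre, -⟩ := exists_zigzag_sub ht h h'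
  rw [hz, norm_mul, norm_dir, one_mul]
  linarith [Complex.abs_re_le_norm z]

/-- Distinct points of the limit set see each other nearly in the direction of their last common
segment. -/
lemma le_abs_inner_zigzag_sub {n : ℕ} {s t : ℝ} (ht : t ∈ params)
    (h : cell n s = cell n t) (h' : cell (n + 1) s ≠ cell (n + 1) t) :
    (1 - 8 * chord n) * ‖zigzag s - zigzag t‖ ≤
      |inner ℝ (dir n t) (zigzag s - zigzag t)| := by
  obtain ⟨z, hz, hre, him⟩ := exists_zigzag_sub ht h h'
  have h1 : inner ℝ (dir n t) (zigzag s - zigzag t) = z.re := by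
    have h2 : starRingEnd ℂ (dir n t) * dir n t = 1 := by
      rw [mul_comm, Complex.mul_conj, Complex.normSq_eq_norm_sq, norm_dir]; simp
    rw [hz, Complex.inner, mul_right_comm, mul_comm (dir n t), h2, one_mul]
  rw [h1, hz, norm_mul, norm_dir, one_mul]
  have h3 := Complex.norm_le_abs_re_add_abs_im z
  have h4 := chord_nonneg n
  have h5 := mul_le_mul_of_nonneg_left ((by linarith : |s - t| ≤ 4 * |z.re|).trans
    (mul_le_mul_of_nonneg_left (Complex.abs_re_le_norm z) (by norm_num))) h4
  linarith

/-! ### Compactness and measure of the limit set -/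

lemma isCompact_params : IsCompact params := by
  have : params = Icc (0 : ℝ) 1 ∩ ⋂ (n : ℕ) (j : ℤ), {t : ℝ | gap n ≤ |scale n * t - j|} := by
    ext t; simp [params]
  rw [this]
  refine isCompact_Icc.inter_right (isClosed_iInter fun n => isClosed_iInter fun j => ?_)
  exact isClosed_le continuous_const (by fun_prop)

lemma continuousOn_zigzag : ContinuousOn zigzag params := by
  refine Metric.continuousOn_iff.2 fun t ht ε hε => ?_
  have h3 : Tendsto (fun n => 3 * ((1 : ℝ) / scale n)) atTop (𝓝 (3 * 0)) :=
    tendsto_inv_scale.const_mul 3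
  rw [mul_zero] at h3
  obtain ⟨n, hn⟩ := (h3.eventually_lt_const hε).exists
  refine ⟨gap n / scale n, div_pos (gap_pos n) (scale_pos n), fun s _ hst => ?_⟩
  rw [dist_eq_norm]
  refine (norm_zigzag_sub_le (cell_eq_of_abs_sub_lt ht hst)).trans_lt ?_
  rwa [mul_one_div] at hn

/-- There are `scale n + 1` grid points, each removing length `2 * gap n / scale n`. These bounds
sum to `1 / 2`, which leaves positive length for `params`. -/
lemma volume_near_grid_le (n : ℕ) :
    volume {t : ℝ | t ∈ Icc (0 : ℝ) 1 ∧ ∃ j : ℤ, |scale n * t - j| < gap n} ≤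
      ENNReal.ofReal (1 / 4 * (1 / 2) ^ n) := by
  have hM := scale_pos n
  have hM1 : (1 : ℝ) ≤ scale n := (one_le_pow₀ one_le_two).trans (two_pow_le_scale n)
  have hg := gap_pos n
  have hg1 : gap n < 1 := pow_lt_one₀ (by norm_num) (by norm_num) (by omega)
  have hsub : {t : ℝ | t ∈ Icc (0 : ℝ) 1 ∧ ∃ j : ℤ, |scale n * t - j| < gap n} ⊆
      ⋃ i ∈ Finset.range (scale n + 1), Metric.ball ((i : ℝ) / scale n) (gap n / scale n) := by
    rintro t ⟨⟨h0, h1⟩, j, hj⟩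
    have h2 := abs_lt.1 hj
    have h3 : (scale n : ℝ) * t ≤ scale n := by nlinarith
    have h4 : 0 ≤ (scale n : ℝ) * t := by positivity
    have hj0 : 0 ≤ j := by
      have : (-1 : ℝ) < j := by linarith
      have : (-1 : ℤ) < j := by exact_mod_cast this
      omega
    have hj1 : j < scale n + 1 := by
      have : (j : ℝ) < scale n + 1 := by linarith
      exact_mod_cast this
    lift j to ℕ using hj0
    refine mem_biUnion (x := j) (by simp; omega) ?_
    rw [Metric.mem_ball, Real.dist_eq, lt_div_iff₀ hM]
    calc |t - j / scale n| * scale n = |(t - j / scale n) * scale n| := by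
          rw [abs_mul, abs_of_pos hM]
      _ = |scale n * t - (j : ℤ)| := by congr 1; field_simp; simp
      _ < gap n := hj
  refine (measure_mono hsub).trans ((measure_biUnion_finset_le _ _).trans ?_)
  simp only [Real.volume_ball, Finset.sum_const, Finset.card_range, nsmul_eq_mul]
  rw [← ENNReal.ofReal_natCast, ← ENNReal.ofReal_mul (Nat.cast_nonneg _)]
  refine ENNReal.ofReal_le_ofReal ?_
  push_cast
  rw [mul_div_assoc', mul_div_assoc', div_le_iff₀ hM]
  have : gap n = 1 / 16 * (1 / 2) ^ n := by rw [gap, pow_add]; norm_num; ring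
  have hp : (0 : ℝ) < (1 / 2) ^ n := by positivity
  rw [this]
  nlinarith

lemma volume_params_pos : 0 < volume params := by
  have hsub : Icc (0 : ℝ) 1 ⊆ params ∪
      ⋃ n : ℕ, {t : ℝ | t ∈ Icc (0 : ℝ) 1 ∧ ∃ j : ℤ, |scale n * t - j| < gap n} := by
    intro t ht
    by_cases h : t ∈ params
    · exact Or.inl h
    · have h' : ∃ (n : ℕ) (j : ℤ), |scale n * t - j| < gap n := by
        by_contra! h'
        exact h ⟨ht, h'⟩
      obtain ⟨n, j, hj⟩ := h'
      exact Or.inr (mem_iUnion.2 ⟨n, ht, j, hj⟩)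
  by_contra h0
  have h0 : volume params = 0 := by simpa using h0
  have hs : HasSum (fun n : ℕ => (1 : ℝ) / 4 * (1 / 2) ^ n) (1 / 4 * 2) :=
    hasSum_geometric_two.mul_left _
  have h1 := (measure_mono hsub).trans ((measure_union_le _ _).trans
    (add_le_add_right ((measure_iUnion_le _).trans (ENNReal.tsum_le_tsum volume_near_grid_le)) _))
  rw [h0, zero_add, ← ENNReal.ofReal_tsum_of_nonneg (fun n => by positivity) hs.summable,
    hs.tsum_eq, Real.volume_Icc] at h1
  rw [ENNReal.ofReal_le_ofReal_iff (by norm_num)] at h1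
  norm_num at h1

lemma ediam_zigzag_cell_le (n : ℕ) (j : ℤ) :
    Metric.ediam (zigzag '' {t | cell n t = j}) ≤ ENNReal.ofReal (3 / scale n) := by
  refine Metric.ediam_le ?_
  rintro _ ⟨s, hs, rfl⟩ _ ⟨t, ht, rfl⟩
  rw [edist_dist, dist_eq_norm]
  exact ENNReal.ofReal_le_ofReal (norm_zigzag_sub_le (hs.trans ht.symm))

/-- The images of the cells meeting the interval form a cover by at most `scale n * (b - a) + 2`
sets of diameter at most `3 / scale n`. -/
lemma hausdorffMeasure_zigzag_image_Ioc_le {a b : ℝ} (hab : a ≤ b) :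
    Measure.hausdorffMeasure 1 (zigzag '' Ioc a b) ≤ 3 * ENNReal.ofReal (b - a) := by
  have hr : Tendsto (fun n => 3 * ((1 : ℝ) / scale n)) atTop (𝓝 (3 * 0)) :=
    tendsto_inv_scale.const_mul 3
  rw [mul_zero] at hr
  have hr' : Tendsto (fun n => ENNReal.ofReal (3 / scale n)) atTop (𝓝 0) := by
    simpa only [mul_one_div, ENNReal.ofReal_zero] using ENNReal.tendsto_ofReal hr
  refine (Measure.hausdorffMeasure_le_liminf_sum (ι := fun n => Finset.Icc (cell n a) (cell n b)) 1
    _ _ hr' (fun n j => zigzag '' {t | cell n t = j})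
    (Eventually.of_forall fun n j => ediam_zigzag_cell_le n j)
    (Eventually.of_forall fun n => ?_)).trans ?_
  · rintro _ ⟨t, ht, rfl⟩
    have h1 : cell n a ≤ cell n t :=
      Int.floor_mono (mul_le_mul_of_nonneg_left ht.1.le (scale_pos n).le)
    have h2 : cell n t ≤ cell n b :=
      Int.floor_mono (mul_le_mul_of_nonneg_left ht.2 (scale_pos n).le)
    exact mem_iUnion.2 ⟨⟨cell n t, Finset.mem_Icc.2 ⟨h1, h2⟩⟩, t, rfl, rfl⟩
  have hlim : Tendsto (fun n => ENNReal.ofReal (3 * (b - a) + 6 * (1 / scale n))) atTop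
      (𝓝 (3 * ENNReal.ofReal (b - a))) := by
    have h1 : Tendsto (fun n => 3 * (b - a) + 6 * ((1 : ℝ) / scale n)) atTop
        (𝓝 (3 * (b - a) + 6 * 0)) := (tendsto_inv_scale.const_mul 6).const_add _
    have h2 := ENNReal.tendsto_ofReal h1
    rwa [mul_zero, add_zero, ENNReal.ofReal_mul (by norm_num), ENNReal.ofReal_ofNat] at h2
  rw [← hlim.liminf_eq]
  refine liminf_le_liminf (Eventually.of_forall fun n => ?_)
  have hM := scale_pos n
  calc ∑ j : Finset.Icc (cell n a) (cell n b),
        Metric.ediam (zigzag '' {t | cell n t = j}) ^ (1 : ℝ)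
      ≤ ∑ _j : Finset.Icc (cell n a) (cell n b), ENNReal.ofReal (3 / scale n) :=
        Finset.sum_le_sum fun j _ => by
          rw [ENNReal.rpow_one]; exact ediam_zigzag_cell_le n j
    _ = ENNReal.ofReal ((cell n b + 1 - cell n a).toNat * (3 / scale n)) := by
        rw [ENNReal.ofReal_mul (Nat.cast_nonneg _), ENNReal.ofReal_natCast]
        simp
    _ ≤ _ := by
        refine ENNReal.ofReal_le_ofReal ?_
        have h1 : cell n a ≤ cell n b :=
          Int.floor_mono (mul_le_mul_of_nonneg_left hab (scale_pos n).le)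
        have h2 : (((cell n b + 1 - cell n a).toNat : ℤ) : ℝ) = cell n b + 1 - cell n a := by
          rw [Int.toNat_of_nonneg (by omega)]; push_cast; ring
        rw [Int.cast_natCast] at h2
        have h3 : (cell n b : ℝ) ≤ scale n * b := Int.floor_le _
        have h4 : (scale n : ℝ) * a < cell n a + 1 := Int.lt_floor_add_one _
        calc ((cell n b + 1 - cell n a).toNat : ℝ) * (3 / scale n)
            ≤ (scale n * (b - a) + 2) * (3 / scale n) := by
              rw [h2]; gcongr; linarith
          _ = _ := by field_simp; ring

/-- `zigzag` is not Lipschitz, as the pieces pull apart at cell endpoints. Lebesgue outer measure is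
however the largest outer measure bounded by length on half-open intervals, so those suffice, and
`Z` need not be measurable. -/
lemma hausdorffMeasure_zigzag_image_le (Z : Set ℝ) :
    Measure.hausdorffMeasure 1 (zigzag '' Z) ≤ 3 * volume Z := by
  have h : OuterMeasure.comap zigzag
      (Measure.hausdorffMeasure 1 : Measure ℂ).toOuterMeasure ≤
      (3 : ENNReal) • StieltjesFunction.outer StieltjesFunction.id := by
    rw [StieltjesFunction.outer, OuterMeasure.smul_ofFunction (by simp),
      OuterMeasure.le_ofFunction]
    intro s
    rw [Pi.smul_apply, StieltjesFunction.length_eq, smul_eq_mul, ENNReal.mul_iInf_of_ne (by simp)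
      (by simp)]
    refine le_iInf fun a => ?_
    rw [ENNReal.mul_iInf_of_ne (by simp) (by simp)]
    refine le_iInf fun b => ?_
    rw [ENNReal.mul_iInf_of_ne (by simp) (by simp)]
    refine le_iInf fun hs => ?_
    -- The real line has no least element, so nothing is removed from the covered set.
    rw [show (botSet : Set ℝ) = ∅ by ext; simp [botSet], sdiff_empty] at hs
    rw [OuterMeasure.comap_apply]
    refine (measure_mono (image_mono hs)).trans ?_
    rcases le_total a b with hab | hab
    · exact hausdorffMeasure_zigzag_image_Ioc_le hab
    · rw [Ioc_eq_empty (not_lt.2 hab)]; simp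
  have h1 := h Z
  rw [Real.volume_eq_stieltjes_id, StieltjesFunction.measure]
  exact h1

lemma hausdorffMeasure_zigzag_image_cell_le (n : ℕ) (j : ℤ) :
    Measure.hausdorffMeasure 1 (zigzag '' {t | cell n t = j}) ≤ ENNReal.ofReal (3 / scale n) := by
  have hM := scale_pos n
  have hsub : {t | cell n t = j} ⊆ Icc ((j : ℝ) / scale n) ((j + 1) / scale n) := by
    intro t ht
    have ht' := Int.floor_eq_iff.1 (show ⌊(scale n : ℝ) * t⌋ = j from ht)
    rw [mem_Icc, div_le_iff₀' hM, le_div_iff₀' hM]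
    exact ⟨ht'.1, ht'.2.le⟩
  refine (hausdorffMeasure_zigzag_image_le _).trans ?_
  rw [div_eq_mul_inv, ENNReal.ofReal_mul (by norm_num), ENNReal.ofReal_ofNat]
  gcongr
  refine (measure_mono hsub).trans_eq ?_
  rw [Real.volume_Icc]
  congr 1
  field_simp
  ring

lemma exists_lipschitz_leftInverse :
    ∃ h : ℂ → ℝ, LipschitzWith 4 h ∧ ∀ t ∈ params, h (zigzag t) = t := by
  have hinj : InjOn zigzag params := fun s hs t ht hst => by
    have := abs_sub_le_norm_zigzag_sub hs ht
    rw [hst, sub_self, norm_zero, mul_zero] at this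
    exact sub_eq_zero.1 (abs_nonpos_iff.1 this)
  have hinv : ∀ t ∈ params, Function.invFunOn zigzag params (zigzag t) = t :=
    fun t ht => hinj.leftInvOn_invFunOn ht
  have hlip : LipschitzOnWith 4 (Function.invFunOn zigzag params) (zigzag '' params) := by
    refine LipschitzOnWith.of_dist_le_mul ?_
    rintro _ ⟨s, hs, rfl⟩ _ ⟨t, ht, rfl⟩
    rw [hinv s hs, hinv t ht, dist_eq_norm, dist_eq_norm]
    simpa using abs_sub_le_norm_zigzag_sub hs ht
  obtain ⟨h, hh, heq⟩ := hlip.extend_real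
  exact ⟨h, hh, fun t ht => by rw [← heq (mem_image_of_mem _ ht), hinv t ht]⟩

lemma hausdorffMeasure_zigzag_image_params_pos :
    0 < Measure.hausdorffMeasure 1 (zigzag '' params) := by
  obtain ⟨h, hh, hinv⟩ := exists_lipschitz_leftInverse
  have h1 : h '' (zigzag '' params) = params := by
    rw [image_image, image_congr hinv, image_id']
  have h2 := hh.hausdorffMeasure_image_le zero_le_one (zigzag '' params)
  rw [h1, hausdorffMeasure_real] at h2
  refine pos_iff_ne_zero.2 fun h0 => ?_
  rw [h0, mul_zero] at h2
  exact volume_params_pos.not_ge h2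

lemma hausdorffMeasure_zigzag_image_params_lt_top :
    Measure.hausdorffMeasure 1 (zigzag '' params) < ⊤ :=
  (hausdorffMeasure_zigzag_image_le _).trans_lt
    (ENNReal.mul_lt_top (by simp) isCompact_params.measure_lt_top)

/-! ### Directions diverge almost everywhere -/

lemma measurable_dir (n : ℕ) : Measurable (dir n) := by
  induction n with
  | zero => exact measurable_const
  | succ n ih =>
    have h : Measurable fun t => cell (n + 1) t :=
      Int.measurable_floor.comp (measurable_const_mul _)
    have h' : Measurable fun j : ℤ => (⟨cosTurn n, altSign j * sinTurn n⟩ : ℂ) :=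
      measurable_from_top
    exact ih.mul (h'.comp h)

lemma integrableOn_dir (n : ℕ) {s : Set ℝ} (hs : volume s ≠ ⊤) : IntegrableOn (dir n) s :=
  Measure.integrableOn_of_bounded (M := 1) hs (measurable_dir n).aestronglyMeasurable
    (Eventually.of_forall fun t => (norm_dir n t).le)

lemma intervalIntegrable_dir (n : ℕ) (a b : ℝ) : IntervalIntegrable (dir n) volume a b :=
  ⟨integrableOn_dir n (by simp), integrableOn_dir n (by simp)⟩

lemma cell_eq_iff {n : ℕ} {j : ℤ} {t : ℝ} :
    cell n t = j ↔ t ∈ Ico ((j : ℝ) / scale n) ((j + 1) / scale n) := by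
  rw [cell, Int.floor_eq_iff, mem_Ico, div_le_iff₀' (scale_pos n), lt_div_iff₀' (scale_pos n)]

lemma cell_left (n : ℕ) (j : ℤ) : cell n ((j : ℝ) / scale n) = j := by
  rw [cell, mul_div_cancel₀ _ (scale_pos n).ne', Int.floor_intCast]

lemma sum_altSign_eq_zero (a : ℤ) (m : ℕ) :
    ∑ i ∈ Finset.range (2 * m), altSign (a + i) = 0 := by
  induction m with
  | zero => simp
  | succ m ih =>
    rw [mul_add, mul_one, Finset.sum_range_succ, Finset.sum_range_succ, ih]
    push_cast
    rw [← add_assoc, altSign_add_one]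
    ring

lemma integral_dir_self (n : ℕ) (j : ℤ) :
    ∫ t in ((j : ℝ) / scale n)..((j + 1) / scale n), dir n t =
      (1 / scale n : ℝ) * dir n (j / scale n) := by
  have hM := scale_pos n
  have hle : (j : ℝ) / scale n ≤ (j + 1) / scale n := by gcongr; linarith
  rw [intervalIntegral.integral_of_le hle, integral_Ioc_eq_integral_Ioo,
    setIntegral_congr_fun (g := fun _ => dir n (j / scale n)) measurableSet_Ioo
      fun t ht => dir_eq_of_cell_eq
        ((cell_eq_iff.2 ⟨ht.1.le, ht.2⟩).trans (cell_left n j).symm),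
    setIntegral_const, Measure.real, Real.volume_Ioo, ENNReal.toReal_ofReal (sub_nonneg.2 hle),
    Complex.real_smul]
  congr 2
  ring

/-- Each cell has an even number of subcells with alternating turns, so the sines cancel and every
generation contributes one factor `cosTurn`. -/
lemma integral_dir (d n : ℕ) (j : ℤ) :
    ∫ t in ((j : ℝ) / scale n)..((j + 1) / scale n), dir (n + d) t =
      ((∏ k ∈ Finset.range d, cosTurn (n + k)) / scale n : ℝ) * dir n (j / scale n) := by
  induction d generalizing n j with
  | zero => simpa using integral_dir_self n j
  | succ d ih =>
    have hM := (scale_pos n).ne'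
    have hM' := (scale_pos (n + 1)).ne'
    set N : ℕ := 2 ^ (2 * n + 10) with hN
    have hMN : (scale (n + 1) : ℝ) = scale n * N := by rw [scale_succ_real, hN]; push_cast; rfl
    have hN0 : (N : ℝ) ≠ 0 := by rw [hN]; positivity
    have hN2 : N = 2 * 2 ^ (2 * n + 9) := by rw [hN, pow_succ 2 (2 * n + 9)]; ring
    set a : ℕ → ℝ := fun i => ((j * N + i : ℤ) : ℝ) / scale (n + 1) with ha
    have hs := intervalIntegral.sum_integral_adjacent_intervals (μ := volume)
      (f := dir (n + (d + 1))) (a := a) (n := N) fun k _ => intervalIntegrable_dir _ _ _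
    have h0 : a 0 = j / scale n := by rw [ha]; simp only; push_cast; rw [hMN]; field_simp; simp
    have h1 : a N = (j + 1) / scale n := by rw [ha]; simp only; push_cast; rw [hMN]; field_simp
    rw [← h0, ← h1, ← hs]
    have hstep : ∀ i ∈ Finset.range N, ∫ t in a i..a (i + 1), dir (n + (d + 1)) t =
        ((∏ k ∈ Finset.range d, cosTurn (n + 1 + k)) / scale (n + 1) : ℝ) *
          (dir n (a 0) * ⟨cosTurn n, altSign (j * N + i) * sinTurn n⟩) := by
      intro i hi
      have h2 := ih (n + 1) (j * N + i)
      have h3 : a (i + 1) = (((j * N + i : ℤ) : ℝ) + 1) / scale (n + 1) := by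
        rw [ha]; simp only; push_cast; ring
      have h4 : dir n (((j * N + i : ℤ) : ℝ) / scale (n + 1)) = dir n (a 0) := by
        refine dir_eq_of_cell_eq ?_
        rw [h0, cell_left, cell_eq_ediv, cell_left, ← hN]
        have hi' : (i : ℤ) < N := by exact_mod_cast Finset.mem_range.1 hi
        rw [add_comm, Int.add_mul_ediv_right _ _ (by positivity),
          Int.ediv_eq_zero_of_lt (by positivity) hi', zero_add]
      rw [h3, show n + (d + 1) = n + 1 + d by ring, h2, dir, turn, cell_left, h4]
    rw [Finset.sum_congr rfl hstep, ← Finset.mul_sum, ← Finset.mul_sum]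
    have hsum : ∑ i ∈ Finset.range N, (⟨cosTurn n, altSign (j * N + i) * sinTurn n⟩ : ℂ) =
        ((N * cosTurn n : ℝ) : ℂ) := by
      apply Complex.ext
      · simp [Complex.re_sum]
      · rw [Complex.im_sum, ← Finset.sum_mul]
        conv_lhs => rw [hN2]
        rw [sum_altSign_eq_zero]
        simp
    have hprod : ∏ k ∈ Finset.range d, cosTurn (n + (k + 1)) =
        ∏ k ∈ Finset.range d, cosTurn (n + 1 + k) :=
      Finset.prod_congr rfl fun k _ => by rw [add_assoc, add_comm 1]
    rw [hsum, Finset.prod_range_succ', add_zero, hMN, hprod]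
    push_cast
    have : (scale n : ℂ) ≠ 0 := by exact_mod_cast hM
    have : (N : ℂ) ≠ 0 := by exact_mod_cast hN0
    field_simp

lemma prod_cosTurn (n d : ℕ) :
    ∏ k ∈ Finset.range d, cosTurn (n + k) = (n + 1) / (n + d + 1) := by
  induction d with
  | zero =>
    have : (n : ℝ) + 1 ≠ 0 := by positivity
    simp [this]
  | succ d ih =>
    have : (n : ℝ) + d + 1 ≠ 0 := by positivity
    have : (n : ℝ) + d + 2 ≠ 0 := by positivity
    rw [Finset.prod_range_succ, ih, cosTurn]
    push_cast
    rw [show (n : ℝ) + (d + 1) + 1 = n + d + 2 by ring]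
    field_simp

lemma tendsto_integral_dir (n : ℕ) (j : ℤ) :
    Tendsto (fun d => ∫ t in ((j : ℝ) / scale n)..((j + 1) / scale n), dir (n + d) t)
      atTop (𝓝 0) := by
  simp_rw [integral_dir, prod_cosTurn]
  have h : Tendsto (fun d : ℕ => ((n : ℝ) + 1) / (n + d + 1)) atTop (𝓝 0) :=
    tendsto_const_nhds.div_atTop (tendsto_atTop_add_const_right _ _
      (tendsto_atTop_add_const_left _ _ tendsto_natCast_atTop_atTop))
  have h1 := (Complex.continuous_ofReal.tendsto _).comp (h.div_const (scale n : ℝ))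
  simpa [Function.comp_def] using h1.mul_const (dir n (j / scale n))

/-- At a density point the set fills over nine tenths of some cell. There the mean of `dir (n + d)`
stays near `c`, of modulus at least `9 / 10`, although it tends to `0` as `d` grows. -/
lemma volume_setOf_dir_near_eq_zero (c : ℂ) (n₀ : ℕ) :
    volume {t | ∀ m ≥ n₀, ‖dir m t - c‖ ≤ 1 / 10} = 0 := by
  set T := {t | ∀ m ≥ n₀, ‖dir m t - c‖ ≤ 1 / 10} with hT
  have hTm : MeasurableSet T := by
    simp only [hT, ge_iff_le, ofPred_forall]
    exact MeasurableSet.iInter fun m => MeasurableSet.iInter fun _ =>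
      measurableSet_le ((measurable_dir m).sub_const c).norm measurable_const
  by_contra h0
  have : (ae (volume.restrict T)).NeBot := ae_restrict_neBot.2 h0
  obtain ⟨t, ht, htT⟩ := ((IsUnifLocDoublingMeasure.ae_tendsto_measure_inter_div
    (volume : Measure ℝ) T 1).and (ae_restrict_mem hTm)).exists
  have hc1 : ‖c‖ ≤ 11 / 10 := by
    have h1 := htT n₀ le_rfl
    have h2 := norm_sub_norm_le c (dir n₀ t)
    rw [norm_dir, norm_sub_rev] at h2
    linarith
  have hc2 : 9 / 10 ≤ ‖c‖ := by
    have h1 := htT n₀ le_rfl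
    have h2 := norm_sub_norm_le (dir n₀ t) c
    rw [norm_dir] at h2
    linarith
  have hr : Tendsto (fun n => 1 / 2 * ((1 : ℝ) / scale n)) atTop (𝓝[>] 0) := by
    refine tendsto_nhdsWithin_iff.2 ⟨?_, Eventually.of_forall fun n => ?_⟩
    · have h := tendsto_inv_scale.const_mul (1 / 2)
      rwa [mul_zero] at h
    · exact mul_pos (by norm_num) (div_pos one_pos (scale_pos n))
  -- The density theorem with non-centred balls applies to the cells themselves: the centre is that
  -- of the cell, the radius half its length.
  have hlim := ht (fun n => ((cell n t : ℝ) + 1 / 2) / scale n) _ hr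
    (Eventually.of_forall fun n => by
      rw [Metric.mem_closedBall, Real.dist_eq, one_mul, mul_one_div]
      exact abs_offset_le n t)
  have hlim' := (ENNReal.tendsto_toReal ENNReal.one_ne_top).comp hlim
  obtain ⟨n, hn⟩ := (hlim'.eventually_const_lt (u := 9 / 10) (by simp; norm_num)).exists
  have hM := scale_pos n
  obtain ⟨j, hj⟩ : ∃ j, cell n t = j := ⟨_, rfl⟩
  have hball : Metric.closedBall (((j : ℝ) + 1 / 2) / scale n) (1 / 2 * (1 / scale n)) =
      Icc ((j : ℝ) / scale n) ((j + 1) / scale n) := by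
    rw [Real.closedBall_eq_Icc]
    congr 1 <;> ring
  simp only [Function.comp_apply, hj, hball, ENNReal.toReal_div] at hn
  set I := Icc ((j : ℝ) / scale n) ((j + 1) / scale n) with hI
  have hle : (j : ℝ) / scale n ≤ (j + 1) / scale n := by gcongr; linarith
  have hIvol : volume.real I = 1 / scale n := by
    rw [hI, Measure.real, Real.volume_Icc, ENNReal.toReal_ofReal (sub_nonneg.2 hle)]
    ring
  have hIfin : volume I ≠ ⊤ := by simp [hI]
  change 9 / 10 < volume.real (T ∩ I) / volume.real I at hn
  have hIpos : 0 < volume.real I := by rw [hIvol]; positivity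
  rw [lt_div_iff₀ hIpos] at hn
  have hsplit : volume.real (I ∩ T) + volume.real (I \ T) = volume.real I :=
    measureReal_inter_add_sdiff hTm hIfin
  rw [inter_comm] at hn
  have hev := (tendsto_integral_dir n j).norm
  rw [norm_zero] at hev
  obtain ⟨d, hd, hdn⟩ := ((hev.eventually_lt_const (u := 1 / 10 * volume.real I)
    (by positivity)).and (eventually_ge_atTop n₀)).exists
  rw [intervalIntegral.integral_of_le hle, ← integral_Icc_eq_integral_Ioc, ← hI] at hd
  have hint : IntegrableOn (fun t => dir (n + d) t - c) I :=
    (integrableOn_dir _ hIfin).sub (integrableOn_const hIfin)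
  have h1 : ∫ t in I, (dir (n + d) t - c) = (∫ t in I, dir (n + d) t) - volume.real I • c := by
    rw [integral_sub (integrableOn_dir _ hIfin) (integrableOn_const hIfin), setIntegral_const]
  have h2 := integral_inter_add_sdiff hTm hint
  have h3 : ‖∫ t in I ∩ T, (dir (n + d) t - c)‖ ≤ 1 / 10 * volume.real (I ∩ T) :=
    norm_setIntegral_le_of_norm_le_const
      ((measure_mono inter_subset_left).trans_lt hIfin.lt_top)
      fun t ht => ht.2 (n + d) (by omega)
  have h4 : ‖∫ t in I \ T, (dir (n + d) t - c)‖ ≤ 21 / 10 * volume.real (I \ T) :=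
    norm_setIntegral_le_of_norm_le_const
      ((measure_mono sdiff_subset).trans_lt hIfin.lt_top)
      fun t _ => (norm_sub_le _ _).trans (by rw [norm_dir]; linarith)
  have h5 := norm_add_le (∫ t in I ∩ T, (dir (n + d) t - c)) (∫ t in I \ T, (dir (n + d) t - c))
  rw [h2, h1] at h5
  have h6 := norm_sub_norm_le (volume.real I • c) (∫ t in I, dir (n + d) t)
  rw [norm_sub_rev, norm_smul, Real.norm_eq_abs, abs_of_pos hIpos] at h6
  nlinarith

lemma ae_not_tendsto_dir : ∀ᵐ t : ℝ, ¬ ∃ l, Tendsto (fun n => dir n t) atTop (𝓝 l) := by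
  rw [ae_iff]
  refine measure_mono_null (t := ⋃ (k : ℕ) (n₀ : ℕ),
    {t | ∀ m ≥ n₀, ‖dir m t - TopologicalSpace.denseSeq ℂ k‖ ≤ 1 / 10}) ?_
    (measure_iUnion_null fun k => measure_iUnion_null fun n₀ => volume_setOf_dir_near_eq_zero _ n₀)
  intro t ht
  obtain ⟨l, hl⟩ := not_not.1 ht
  obtain ⟨_, hk, k, rfl⟩ := Metric.dense_iff.1 (TopologicalSpace.denseRange_denseSeq ℂ) l
    (1 / 20) (by norm_num)
  obtain ⟨n₀, hn₀⟩ := Metric.tendsto_atTop.1 hl (1 / 20) (by norm_num)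
  refine mem_iUnion₂.2 ⟨k, n₀, fun m hm => ?_⟩
  rw [← dist_eq_norm]
  have h1 := hn₀ m hm
  have h2 := dist_triangle_right (dir m t) (TopologicalSpace.denseSeq ℂ k) l
  rw [Metric.mem_ball] at hk
  linarith

/-! ### Tangents of Lipschitz curves -/

lemma norm_slope_sub_smul_dir_le {n : ℕ} {g : ℝ → ℂ} {p : ℝ → ℝ} {s s' : ℝ}
    (hs : zigzag (p s) = g s) (hs' : zigzag (p s') = g s') (hcell : cell n (p s') = cell n (p s)) :
    ‖slope g s s' - slope p s s' * dir n (p s)‖ ≤ |s' - s|⁻¹ * (2 / scale (n + 1)) := by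
  have h1 := norm_zigzag_sub_sub_le hcell
  rw [hs, hs'] at h1
  have h2 : slope g s s' - slope p s s' * dir n (p s) =
      ((s' - s)⁻¹ : ℝ) * (g s' - g s - (p s' - p s : ℝ) * dir n (p s)) := by
    simp only [slope, vsub_eq_sub, smul_eq_mul, Complex.real_smul]
    push_cast
    ring
  rw [h2, norm_mul, Complex.norm_real, norm_inv, Real.norm_eq_abs]
  refine mul_le_mul_of_nonneg_left (h1.trans ?_) (by positivity)
  have := scale_pos (n + 1)
  have := chord_le_one n
  gcongr
  linarith

/-- A parameter at which the inverse of the zigzag map has, along a set of full density, a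
nonzero derivative is a parameter at which the directions converge. -/
lemma tendsto_dir_of_hasDerivAt {S : Set ℝ} {g : ℝ → ℂ} {p : ℝ → ℝ} {s m : ℝ} {w : ℂ}
    (hS : ∀ u ∈ S, zigzag (p u) = g u) (hs : s ∈ S) (hg : HasDerivAt g w s)
    (hp : HasDerivAt p m s) (hm : m ≠ 0)
    (hdens : ∀ c δ : ℕ → ℝ, Tendsto δ atTop (𝓝[>] 0) →
      (∀ᶠ j in atTop, s ∈ Metric.closedBall (c j) (4 * δ j)) →
        ∀ᶠ j in atTop, (S ∩ Metric.closedBall (c j) (δ j)).Nonempty) :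
    Tendsto (fun n => dir n (p s)) atTop (𝓝 (w / m)) := by
  -- The sign points from `p s` towards the farther end of its cell. A test point near `s + τ n / (4
  -- * scale n * m)` moves `p` by about a quarter cell, and density supplies one in `S`.
  set τ : ℕ → ℝ := fun n => if Int.fract (scale n * p s) < 1 / 2 then 1 else -1 with hτ
  have hτ1 : ∀ n, |τ n| = 1 := fun n => by simp only [hτ]; split_ifs <;> simp
  set r : ℕ → ℝ := fun n => 1 / scale n / (4 * |m|) with hr
  have hmpos : 0 < |m| := abs_pos.2 hm
  have hrpos : ∀ n, 0 < r n := fun n => div_pos (div_pos one_pos (scale_pos n)) (by positivity)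
  have hrlim : Tendsto r atTop (𝓝 0) := by
    have h := tendsto_inv_scale.div_const (4 * |m|)
    rwa [zero_div] at h
  have hshift : ∀ n, |τ n / (4 * scale n * m)| = r n := fun n => by
    have hM := scale_pos n
    rw [abs_div, hτ1, abs_mul, abs_of_pos (by positivity : (0 : ℝ) < 4 * scale n)]
    simp only [hr]
    rw [div_div]
    ring
  have hex := hdens (fun n => s + τ n / (4 * scale n * m)) (fun n => r n / 4)
    (tendsto_nhdsWithin_iff.2 ⟨by simpa using hrlim.div_const 4,
      Eventually.of_forall fun n => div_pos (hrpos n) (by norm_num)⟩)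
    (Eventually.of_forall fun n => by
      rw [Metric.mem_closedBall, dist_comm, Real.dist_eq, add_sub_cancel_left, hshift]
      linarith)
  obtain ⟨q, hq⟩ := hex.choice
  have hq1 : ∀ᶠ n in atTop, 3 / 4 * r n ≤ |q n - s| ∧ |q n - s| ≤ 5 / 4 * r n := by
    filter_upwards [hq] with n hn
    have h1 := hn.2
    rw [Metric.mem_closedBall, Real.dist_eq, ← sub_sub] at h1
    have h2 := abs_sub_abs_le_abs_sub (q n - s) (τ n / (4 * scale n * m))
    have h3 := abs_sub_abs_le_abs_sub (τ n / (4 * scale n * m)) (q n - s)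
    rw [abs_sub_comm (τ n / _) (q n - s)] at h3
    rw [hshift] at h2 h3
    constructor <;> linarith
  have hqlim : Tendsto q atTop (𝓝[≠] s) := by
    refine tendsto_nhdsWithin_iff.2 ⟨?_, ?_⟩
    · rw [tendsto_iff_dist_tendsto_zero]
      refine squeeze_zero' (Eventually.of_forall fun n => dist_nonneg)
        (hq1.mono fun n hn => hn.2) ?_
      simpa using hrlim.const_mul (5 / 4 : ℝ)
    · filter_upwards [hq1] with n hn h
      rw [show q n = s from h, sub_self, abs_zero] at hn
      linarith [hrpos n, hn.1]
  have hgs : Tendsto (fun n => slope g s (q n)) atTop (𝓝 w) := hg.tendsto_slope.comp hqlim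
  have hps : Tendsto (fun n => slope p s (q n)) atTop (𝓝 m) := hp.tendsto_slope.comp hqlim
  have hcell : ∀ᶠ n in atTop, cell n (p (q n)) = cell n (p s) := by
    filter_upwards [hq, (Metric.tendsto_nhds.1 hps) (|m| / 16) (by positivity)] with n hn hn'
    have hM := scale_pos n
    set ρ := slope p s (q n) with hρ
    have h1 : p (q n) = p s + (q n - s) * ρ := by
      have := sub_smul_slope p s (q n)
      rw [smul_eq_mul, vsub_eq_sub] at this
      linarith
    set η := (q n - s) * (4 * scale n * m) - τ n with hη
    have h2 : |η| ≤ 1 / 4 := by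
      have h3 : η = (q n - (s + τ n / (4 * scale n * m))) * (4 * scale n * m) := by
        rw [hη]; field_simp; ring
      have h4 := hn.2
      rw [Metric.mem_closedBall, Real.dist_eq] at h4
      rw [h3, abs_mul]
      calc _ ≤ r n / 4 * |4 * scale n * m| := by gcongr
        _ = 1 / 4 := by
          rw [abs_mul, abs_of_pos (by positivity : (0 : ℝ) < 4 * scale n)]
          simp only [hr]
          field_simp
    set ζ := ρ / m - 1 with hζ
    have h3 : |ζ| ≤ 1 / 16 := by
      have : ζ = (ρ - m) / m := by rw [hζ]; field_simp
      rw [Real.dist_eq] at hn'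
      rw [this, abs_div, div_le_iff₀ hmpos]
      linarith
    -- In units of the cell length the move is `(τ n + η) * (1 + ζ) / 4`: it has the sign of `τ n`
    -- and size below `1 / 2`, so it stays in the cell.
    have h4 : scale n * p (q n) = scale n * p s + (τ n + η) * (1 + ζ) / 4 := by
      rw [h1, hη, hζ]; field_simp; ring
    have hfl := Int.floor_add_fract ((scale n : ℝ) * p s)
    have hf0 := Int.fract_nonneg ((scale n : ℝ) * p s)
    have hf1 := Int.fract_lt_one ((scale n : ℝ) * p s)
    rw [abs_le] at h2 h3
    change ⌊(scale n : ℝ) * p (q n)⌋ = ⌊(scale n : ℝ) * p s⌋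
    rw [h4, Int.floor_eq_iff]
    by_cases hfr : Int.fract ((scale n : ℝ) * p s) < 1 / 2
    · have hτn : τ n = 1 := if_pos hfr
      rw [hτn]
      constructor <;> nlinarith
    · have hτn : τ n = -1 := if_neg hfr
      rw [hτn]
      constructor <;> nlinarith
  -- The error of order `1 / scale (n + 1)` is divided by an increment of order `1 / scale n`.
  have hdiff : Tendsto (fun n => slope g s (q n) - slope p s (q n) * dir n (p s)) atTop (𝓝 0) := by
    have hpow : Tendsto (fun n : ℕ => |m| * ((1 : ℝ) / 2) ^ n) atTop (𝓝 (|m| * 0)) :=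
      (tendsto_pow_atTop_nhds_zero_of_lt_one (by norm_num) (by norm_num)).const_mul _
    rw [mul_zero] at hpow
    refine squeeze_zero_norm' ?_ hpow
    filter_upwards [hq, hq1, hcell] with n hn hn1 hn2
    refine (norm_slope_sub_smul_dir_le (hS s hs) (hS _ hn.1) hn2).trans ?_
    have hM := scale_pos n
    have hrn := hrpos n
    calc |q n - s|⁻¹ * (2 / scale (n + 1)) ≤ (3 / 4 * r n)⁻¹ * (2 / scale (n + 1)) := by
          have := scale_pos (n + 1)
          gcongr
          exact hn1.1
      _ = |m| * (32 / 3 * (1 / 2) ^ (2 * n + 10)) := by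
          rw [scale_succ_real, one_div_pow]
          simp only [hr]
          field_simp
          norm_num
      _ ≤ |m| * (1 / 2) ^ n := by
          gcongr
          have h5 : ((1 : ℝ) / 2) ^ (2 * n + 10) = (1 / 2) ^ n * ((1 / 2) ^ n * (1 / 2) ^ 10) := by
            ring
          have h6 : ((1 : ℝ) / 2) ^ n ≤ 1 := pow_le_one₀ (by norm_num) (by norm_num)
          have h7 : (0 : ℝ) < (1 / 2) ^ n := by positivity
          rw [h5]
          nlinarith
  have hprod : Tendsto (fun n => (slope p s (q n) : ℂ) * dir n (p s)) atTop (𝓝 w) := by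
    simpa using hgs.sub hdiff
  have hpc : Tendsto (fun n => (slope p s (q n) : ℂ)) atTop (𝓝 m) :=
    (Complex.continuous_ofReal.tendsto m).comp hps
  have hmc : (m : ℂ) ≠ 0 := by exact_mod_cast hm
  refine (hprod.div hpc hmc).congr' ?_
  filter_upwards [hpc.eventually_ne hmc] with n hn
  exact mul_div_cancel_left₀ _ hn

/-- Pull the curve back to the parameter line by the Lipschitz inverse. The parameters met are
covered by the image of a null set, the critical values of `p`, and parameters where `dir n`
converges; all three are null. -/
lemma hausdorffMeasure_zigzag_inter_range_eq_zero {g : ℝ → ℂ} {C : NNReal}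
    (hg : LipschitzWith C g) :
    Measure.hausdorffMeasure 1 (zigzag '' params ∩ range g) = 0 := by
  obtain ⟨h, hh, hinv⟩ := exists_lipschitz_leftInverse
  set p : ℝ → ℝ := h ∘ g with hp
  have hpl : LipschitzWith (4 * C) p := hh.comp hg
  set S : Set ℝ := g ⁻¹' (zigzag '' params) with hSdef
  have hSm : MeasurableSet S :=
    ((isCompact_params.image_of_continuousOn continuousOn_zigzag).isClosed.preimage
      hg.continuous).measurableSet
  have hSp : ∀ u ∈ S, zigzag (p u) = g u := by
    rintro u ⟨t, ht, hu⟩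
    rw [hp, Function.comp_apply, ← hu, hinv t ht]
  have hsub : zigzag '' params ∩ range g ⊆ zigzag '' (p '' S) := by
    rintro _ ⟨hy, u, rfl⟩
    exact ⟨p u, mem_image_of_mem _ hy, hSp u hy⟩
  suffices h0 : volume (p '' S) = 0 by
    refine measure_mono_null hsub (nonpos_iff_eq_zero.1 ?_)
    refine (hausdorffMeasure_zigzag_image_le _).trans ?_
    rw [h0, mul_zero]
  set P : ℝ → Prop := fun s => DifferentiableAt ℝ g s ∧ DifferentiableAt ℝ p s ∧
    ∀ c δ : ℕ → ℝ, Tendsto δ atTop (𝓝[>] 0) →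
      (∀ᶠ j in atTop, s ∈ Metric.closedBall (c j) (4 * δ j)) →
        ∀ᶠ j in atTop, (S ∩ Metric.closedBall (c j) (δ j)).Nonempty with hP
  have hae : ∀ᵐ s, s ∈ S → P s := by
    have hd := (ae_restrict_iff' hSm).1
      (IsUnifLocDoublingMeasure.ae_tendsto_measure_inter_div (volume : Measure ℝ) S 4)
    filter_upwards [hd, hg.ae_differentiableAt, hpl.ae_differentiableAt] with s h1 h2 h3 hs
    refine ⟨h2, h3, fun c δ hδ hc => ?_⟩
    filter_upwards [(h1 hs c δ hδ hc).eventually_ne one_ne_zero] with n hn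
    refine nonempty_of_measure_ne_zero (μ := volume) fun h0 => hn ?_
    rw [h0, ENNReal.zero_div]
  have hbad : volume (p '' {s | ¬ (s ∈ S → P s)}) = 0 := by
    have h1 := hpl.hausdorffMeasure_image_le zero_le_one {s | ¬ (s ∈ S → P s)}
    rw [hausdorffMeasure_real, ae_iff.1 hae, mul_zero] at h1
    exact nonpos_iff_eq_zero.1 h1
  -- One-dimensional Sard: values at points of zero derivative form a null set.
  have hcrit : volume (p '' {s | HasDerivAt p 0 s}) = 0 := by
    refine addHaar_image_eq_zero_of_det_fderivWithin_eq_zero volume (f' := fun _ => 0) ?_ ?_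
    · intro s hs
      have := (show HasDerivAt p 0 s from hs).hasFDerivAt.hasFDerivWithinAt
        (s := {s | HasDerivAt p 0 s})
      rwa [show ContinuousLinearMap.toSpanSingleton ℝ (0 : ℝ) = 0 by ext; simp] at this
    · intro s _
      simp [ContinuousLinearMap.det]
  refine measure_mono_null ?_ (measure_union_null (measure_union_null hbad hcrit)
    (ae_iff.1 ae_not_tendsto_dir))
  rintro _ ⟨s, hs, rfl⟩
  by_cases hPs : P s
  · obtain ⟨h1, h2, h3⟩ := hPs
    by_cases hm : deriv p s = 0
    · refine Or.inl (Or.inr ⟨s, ?_, rfl⟩)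
      have := h2.hasDerivAt
      rwa [hm] at this
    · exact Or.inr (not_not.2
        ⟨_, tendsto_dir_of_hasDerivAt hSp hs h1.hasDerivAt h2.hasDerivAt hm h3⟩)
  · exact Or.inl (Or.inl ⟨s, fun h => hPs (h hs), rfl⟩)

/-! ### Transfer to the Euclidean plane -/

/-- The standard identification of the complex plane with the Euclidean plane. -/
noncomputable def toPlane : ℂ ≃ₗᵢ[ℝ] EuclideanSpace ℝ (Fin 2) := Complex.orthonormalBasisOneI.repr

/-- A compact purely unrectifiable set that is asymptotically flat at each of its points. -/
noncomputable def flatSet : Set (EuclideanSpace ℝ (Fin 2)) := toPlane '' (zigzag '' params)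

lemma exists_isometry_surjective_line :
    ∃ e : ℝ → EuclideanSpace ℝ (Fin 1), Isometry e ∧ Function.Surjective e := by
  refine ⟨fun t => WithLp.toLp 2 fun _ => t, Isometry.of_dist_eq fun s t => ?_, fun x => ⟨x 0, ?_⟩⟩
  · simp [EuclideanSpace.dist_eq, Real.sqrt_sq dist_nonneg]
  · ext i
    rw [Subsingleton.elim i 0]

lemma isPurelyUnrectifiable_flatSet : IsPurelyUnrectifiable 1 flatSet := by
  rintro E ⟨f, hf, hE⟩
  rw [Nat.cast_one] at hE ⊢
  obtain ⟨e, he, hes⟩ := exists_isometry_surjective_line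
  have hnull : ∀ i, Measure.hausdorffMeasure 1 (flatSet ∩ range (f i)) = 0 := by
    intro i
    obtain ⟨C, hC⟩ := hf i
    have h1 := hausdorffMeasure_zigzag_inter_range_eq_zero
      ((toPlane.symm.isometry.lipschitz.comp hC).comp he.lipschitz)
    rw [hes.range_comp, range_comp, ← toPlane.isometry.hausdorffMeasure_image (Or.inl zero_le_one),
      image_inter toPlane.injective, toPlane.symm.image_eq_preimage_symm,
      toPlane.symm_symm, image_preimage_eq _ toPlane.surjective] at h1
    exact h1
  refine measure_mono_null (t := (E \ ⋃ i, range (f i)) ∪ ⋃ i, flatSet ∩ range (f i)) ?_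
    (measure_union_null hE (measure_iUnion_null hnull))
  rintro x ⟨hxA, hxE⟩
  by_cases hx : x ∈ ⋃ i, range (f i)
  · rw [mem_iUnion] at hx
    obtain ⟨i, hi⟩ := hx
    exact Or.inr (mem_iUnion.2 ⟨i, hxA, hi⟩)
  · exact Or.inl ⟨hxE, hx⟩

/-! ### Flatness in cones -/

/-- The distance to the line orthogonal to a unit vector is bounded below by the component along
that vector. -/
lemma abs_inner_le_infDist_orthogonal {E : Type*} [NormedAddCommGroup E] [InnerProductSpace ℝ E]
    {u : E} (hu : ‖u‖ = 1) (z : E) :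
    |inner ℝ u z| ≤ Metric.infDist z (((ℝ ∙ u)ᗮ : Submodule ℝ E) : Set E) := by
  refine (Metric.le_infDist ⟨0, Submodule.zero_mem _⟩).2 fun v hv => ?_
  have h1 : inner ℝ u v = 0 := Submodule.mem_orthogonal_singleton_iff_inner_right.1 hv
  have h2 : inner ℝ u z = inner ℝ u (z - v) := by rw [inner_sub_right, h1, sub_zero]
  rw [h2, dist_eq_norm]
  simpa [hu] using abs_real_inner_le_norm u (z - v)

lemma norm_dir_sub_dir_le {n m : ℕ} (t : ℝ) (h : m = n ∨ m = n + 1) :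
    ‖dir m t - dir n t‖ ≤ chord n := by
  rcases h with rfl | rfl
  · simpa using chord_nonneg m
  · exact (norm_dir_succ_sub n t).le

/-- A point in the same cell of generation `n` but not of `n + 2` has last common generation `n` or
`n + 1`. Its angular error costs `8 * chord n`, and replacing that direction by `dir n t` costs one
more `chord n`. -/
lemma flatSet_inter_cone_subset {n : ℕ} {t r α : ℝ} (ht : t ∈ params)
    (hr : 4 * r < gap n / scale n) (hα : α ≤ 1 - 9 * chord n) :
    flatSet ∩ cone (toPlane (zigzag t)) r (ℝ ∙ toPlane (dir n t))ᗮ α ⊆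
      toPlane '' (zigzag '' {s | cell (n + 2) s = cell (n + 2) t}) := by
  rintro _ ⟨⟨_, ⟨s, hs, rfl⟩, rfl⟩, hball, hcone⟩
  refine mem_image_of_mem _ (mem_image_of_mem _ ?_)
  rw [Metric.mem_closedBall, toPlane.dist_map, dist_eq_norm] at hball
  rw [mem_ofPred_eq, ← map_sub, toPlane.norm_map] at hcone
  by_contra hne
  have hst : s ≠ t := fun h => hne (by rw [h]; rfl)
  have hn : cell n s = cell n t :=
    cell_eq_of_abs_sub_lt ht (lt_of_le_of_lt (by
      linarith [abs_sub_le_norm_zigzag_sub hs ht]) hr)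
  obtain ⟨m, hm, hm'⟩ := exists_last_common_cell hs ht hst
  have hmn : m = n ∨ m = n + 1 := by
    have h1 : n ≤ m := by
      by_contra! h
      exact hm' (cell_eq_of_le hn h)
    have h2 : m < n + 2 := by
      by_contra! h
      exact hne (cell_eq_of_le hm h)
    omega
  have h1 := le_abs_inner_zigzag_sub ht hm hm'
  have h2 := abs_inner_le_infDist_orthogonal (u := toPlane (dir n t))
    (by rw [toPlane.norm_map, norm_dir]) (toPlane (zigzag s - zigzag t))
  rw [toPlane.inner_map_map] at h2
  have h3 : |inner ℝ (dir m t) (zigzag s - zigzag t)| ≤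
      |inner ℝ (dir n t) (zigzag s - zigzag t)| + chord n * ‖zigzag s - zigzag t‖ := by
    have h4 : inner ℝ (dir m t) (zigzag s - zigzag t) = inner ℝ (dir n t) (zigzag s - zigzag t) +
        inner ℝ (dir m t - dir n t) (zigzag s - zigzag t) := by
      rw [← inner_add_left, add_sub_cancel]
    rw [h4]
    refine (abs_add_le _ _).trans (add_le_add_right ((abs_real_inner_le_norm _ _).trans ?_) _)
    exact mul_le_mul_of_nonneg_right (norm_dir_sub_dir_le t hmn) (norm_nonneg _)
  have h5 : chord m ≤ chord n := chord_antitone (by omega)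
  have h6 := mul_le_mul_of_nonneg_right h5 (norm_nonneg (zigzag s - zigzag t))
  have h7 := mul_le_mul_of_nonneg_right hα (norm_nonneg (zigzag s - zigzag t))
  linarith

lemma infConeRatio_flatSet_le {n : ℕ} {t r α : ℝ} (ht : t ∈ params)
    (hr : 4 * r < gap n / scale n) (hr' : gap (n + 1) / scale (n + 1) ≤ 4 * r)
    (hα : α ≤ 1 - 9 * chord n) :
    infConeRatio 1 flatSet α (toPlane (zigzag t)) r ≤ ENNReal.ofReal ((1 / 2) ^ n) := by
  have hmem : (ℝ ∙ toPlane (dir n t))ᗮ ∈ linSubspaces 2 (2 - 1) := by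
    have hd : toPlane (dir n t) ≠ 0 :=
      norm_ne_zero_iff.1 (by rw [toPlane.norm_map, norm_dir]; exact one_ne_zero)
    have : Fact (Module.finrank ℝ (EuclideanSpace ℝ (Fin 2)) = 1 + 1) := ⟨by simp⟩
    exact Submodule.finrank_orthogonal_span_singleton hd
  have hrpos : 0 < r := by
    have := div_pos (gap_pos (n + 1)) (scale_pos (n + 1))
    linarith
  refine (iInf₂_le _ hmem).trans ?_
  rw [Nat.cast_one, pow_one]
  refine ENNReal.div_le_of_le_mul ?_
  refine (measure_mono (flatSet_inter_cone_subset ht hr hα)).trans ?_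
  rw [toPlane.isometry.hausdorffMeasure_image (Or.inl zero_le_one),
    ← ENNReal.ofReal_mul (by positivity)]
  refine (hausdorffMeasure_zigzag_image_cell_le _ _).trans (ENNReal.ofReal_le_ofReal ?_)
  rw [← mul_one_div, inv_scale_succ_le, pow_add]
  have h1 : (0 : ℝ) < (1 / 2) ^ n := by positivity
  have h2 := mul_le_mul_of_nonneg_left hr' h1.le
  nlinarith

lemma tendsto_infConeRatio_flatSet {α : ℝ} (hα : α < 1) {x : EuclideanSpace ℝ (Fin 2)}
    (hx : x ∈ flatSet) :
    Tendsto (fun r => infConeRatio 1 flatSet α x r) (𝓝[>] 0) (𝓝 0) := by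
  obtain ⟨_, ⟨t, ht, rfl⟩, rfl⟩ := hx
  rw [ENNReal.tendsto_nhds_zero]
  intro ε hε
  have hpow : Tendsto (fun n : ℕ => ENNReal.ofReal ((1 / 2) ^ n)) atTop (𝓝 0) := by
    have : Tendsto (fun n : ℕ => ((1 : ℝ) / 2) ^ n) atTop (𝓝 0) :=
      tendsto_pow_atTop_nhds_zero_of_lt_one (by norm_num) (by norm_num)
    simpa only [ENNReal.ofReal_zero] using ENNReal.tendsto_ofReal this
  have hch : Tendsto (fun n => 9 * chord n) atTop (𝓝 0) := by
    simpa using tendsto_chord.const_mul 9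
  obtain ⟨n₀, hn₀⟩ := eventually_atTop.1 ((hpow.eventually_le_const hε).and
    (hch.eventually_lt_const (sub_pos.2 hα)))
  have hlim : Tendsto (fun n => gap n / scale n) atTop (𝓝 0) := by
    refine squeeze_zero (fun n => (div_pos (gap_pos n) (scale_pos n)).le) (fun n => ?_)
      tendsto_inv_scale
    have := scale_pos n
    have : gap n ≤ 1 := pow_le_one₀ (by norm_num) (by norm_num)
    gcongr
  have hpos : 0 < gap n₀ / scale n₀ / 4 :=
    div_pos (div_pos (gap_pos n₀) (scale_pos n₀)) (by norm_num)
  filter_upwards [Ioo_mem_nhdsGT hpos] with r hr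
  -- The values `gap n / scale n` tend to `0`, so the first one at or below `4 * r` determines the
  -- generation seen at radius `r`.
  have hex : ∃ k, gap (n₀ + k + 1) / scale (n₀ + k + 1) ≤ 4 * r := by
    obtain ⟨N, hN⟩ := eventually_atTop.1
      (hlim.eventually_le_const (show (0 : ℝ) < 4 * r by linarith [hr.1]))
    exact ⟨N, hN _ (by omega)⟩
  classical
  have hlt : 4 * r < gap (n₀ + Nat.find hex) / scale (n₀ + Nat.find hex) := by
    rcases hk : Nat.find hex with _ | k
    · rw [add_zero]; linarith [hr.2]
    · have := Nat.find_min hex (m := k) (by omega)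
      rw [not_le] at this
      exact this
  have hn := hn₀ (n₀ + Nat.find hex) (by omega)
  exact (infConeRatio_flatSet_le ht hlt (Nat.find_spec hex) (by linarith [hn.2])).trans hn.1

lemma hausdorffMeasure_flatSet :
    Measure.hausdorffMeasure 1 flatSet = Measure.hausdorffMeasure 1 (zigzag '' params) :=
  toPlane.isometry.hausdorffMeasure_image (Or.inl zero_le_one) _

end ZigzagCantor

theorem mainTheorem3 :
    ∃ A : Set (EuclideanSpace ℝ (Fin 2)),
      IsCompact A ∧ IsPurelyUnrectifiable 1 A ∧
      0 < Measure.hausdorffMeasure (1 : ℝ) A ∧ Measure.hausdorffMeasure (1 : ℝ) A < ⊤ ∧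
      (∀ α : ℝ, 0 < α → α < 1 → ∀ x ∈ A,
        Tendsto (fun r : ℝ => infConeRatio 1 A α x r) (𝓝[>] 0) (𝓝 0)) ∧
      (∀ α : ℝ, 0 < α → α < 1 → ∀ c : ENNReal, 0 < c →
        ¬ ∀ᵐ x ∂((Measure.hausdorffMeasure (1 : ℝ)).restrict A),
          c < limsup (fun r : ℝ => infConeRatio 1 A α x r) (𝓝[>] 0)) := by
  have hcomp : IsCompact ZigzagCantor.flatSet :=
    (ZigzagCantor.isCompact_params.image_of_continuousOn
      ZigzagCantor.continuousOn_zigzag).image ZigzagCantor.toPlane.continuous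
  have hpos : 0 < Measure.hausdorffMeasure (1 : ℝ) ZigzagCantor.flatSet := by
    rw [ZigzagCantor.hausdorffMeasure_flatSet]
    exact ZigzagCantor.hausdorffMeasure_zigzag_image_params_pos
  refine ⟨ZigzagCantor.flatSet, hcomp, ZigzagCantor.isPurelyUnrectifiable_flatSet, hpos, ?_,
    fun α _ hα x hx => ZigzagCantor.tendsto_infConeRatio_flatSet hα hx, fun α _ hα c hc hae => ?_⟩
  · rw [ZigzagCantor.hausdorffMeasure_flatSet]
    exact ZigzagCantor.hausdorffMeasure_zigzag_image_params_lt_top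
  -- Positive measure yields a point of `A` satisfying the almost-everywhere bound, where the limit
  -- is nevertheless `0`.
  · have : (ae ((Measure.hausdorffMeasure (1 : ℝ)).restrict ZigzagCantor.flatSet)).NeBot :=
      ae_restrict_neBot.2 hpos.ne'
    obtain ⟨x, hx, hxA⟩ := (hae.and (ae_restrict_mem hcomp.measurableSet)).exists
    rw [(ZigzagCantor.tendsto_infConeRatio_flatSet hα hxA).limsup_eq] at hx
    exact not_lt_zero hx
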